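/- **Definitions.** Let $\Sigma_I,\Sigma_O$ be finite alphabets. A deterministic decision tree on inputs $x\in\Sigma_I^n$ has internal nodes labelled by indices in $[n]$ (the position queried; no node shares its label with an ancestor), arcs labelled by $\Sigma_I$ and leaves labelled by output symbols; $D(x)$ is the label of the leaf reached on $x$ and $\mathrm{cost}(D,x)$ is the depth of that leaf. A randomised decision tree $R$ is a probability distribution over deterministic decision trees, and $\mathrm{cost}(R,x)=\mathbb E_{D\sim R}[\mathrm{cost}(D,x)]$. For a (possibly partial) relation $f\subseteq\Sigma_I^n\times\Sigma_O$, let $\mathrm{Dom}(f)$ be the set of $x$ that have at least one valid output, $\mathrm{err}_f(R,x)=\Pr_R[(x,R(x))\notin f]$, and $\mathrm{bias}_f(R,x)=\max\{1-2\,\mathrm{err}_f(R,x),0\}$; a partial function is identified with its graph. Say that $R$ computes $f$ to error $\epsilon$ if $\mathrm{err}_f(R,x)\le\epsilon$ for all $x\in\mathrm{Dom}(f)$. Then - $\mathrm R_\epsilon(f)$ is the least $T$ such that some $R$ computes $f$ to error $\epsilon$ with all trees in its support of height at most $T$, and $\mathrm R(f)=\mathrm R_{1/3}(f)$; - $\overline{\mathrm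 R}_\epsilon(f)=\min_R\max_{x\in\mathrm{Dom}(f)}\mathrm{cost}(R,x)$, where $R$ ranges over the randomised trees that compute $f$ to error $\epsilon$; - for a partial Boolean-valued function $g$, $\mathrm{LR}(g)=\min_R\max_{x\in\mathrm{Dom}(g)}\mathrm{cost}(R,x)/\mathrm{bias}_g(R,x)$, where $R$ ranges over all randomised trees with outputs in $\{0,1\}$ and a ratio with denominator $0$ (including $0/0$) is $\infty$. Minima over an empty set are $\infty$, maxima over an empty set are $0$, and $0\cdot\infty=0$. For a relation $f\subseteq\{0,1\}^n\times\Sigma_O$ and a partial function $g\colon\mathrm{Dom}(g)\to\{0,1\}$ with $\mathrm{Dom}(g)\subseteq\Sigma_I^m$, the composition $f\circ g\subseteq(\Sigma_I^m)^n\times\Sigma_O$ consists of all $((x^1,\dots,x^n),o)$ such that $x^i\in\mathrm{Dom}(g)$ for every $i$ and $((g(x^1),\dots,g(x^n)),o)\in f$. **Theorem.** 1. There is a universal constant $c>0$ such that for all $n,m\in\mathbb N$ and all partial Boolean functions $f$ on $\{0,1\}^n$ and $g$ on $\{0,1\}^m$, $$\mathrm R(f\circ g)\ \ge\ c\cdot\mathrm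 R(f)\cdot\mathrm{LR}(g).$$ 2. For all finite alphabets $\Sigma_I,\Sigma_O$, all $n,m\in\mathbb N$, every (possibly partial) relation $f\subseteq\{0,1\}^n\times\Sigma_O$, every (possibly partial) function $g\colon\mathrm{Dom}(g)\to\{0,1\}$ with $\mathrm{Dom}(g)\subseteq\Sigma_I^m$, and every $\epsilon\in[0,1/2)$, $$\overline{\mathrm R}_\epsilon(f\circ g)\ \ge\ \overline{\mathrm R}_\epsilon(f)\cdot\mathrm{LR}(g)/6.$$ -/

import Mathlib

open scoped ENNReal NNReal

/-! # Query complexity of partial functions and relations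

Inputs are strings `x : ι → A` with positions `ι` and input alphabet `A`; outputs lie in `O`.
A (possibly partial) relation is a set `f ⊆ (ι → A) × O`, and a partial function
`g : (ι → A) →. O` gives rise to the relation `g.graph`. -/

namespace QueryComplexity

variable {ι A O : Type*}

/-- Deterministic decision trees: internal nodes are labelled by the queried position, the arcs
below an internal node by the symbols of the input alphabet, the leaves by outputs. -/
inductive DecisionTree (ι A O : Type*) where
  | leaf (o : O) : DecisionTree ι A O
  | query (i : ι) (next : A → DecisionTree ι A O) : DecisionTree ι A O

namespace DecisionTree

/-- The output `D(x)`: the label of the leaf reached on input `x`. -/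
def eval : DecisionTree ι A O → (ι → A) → O
  | leaf o, _ => o
  | query i next, x => (next (x i)).eval x

/-- `cost(D, x)`: the number of queries made on input `x`. -/
def cost : DecisionTree ι A O → (ι → A) → ℕ
  | leaf _, _ => 0
  | query i next, x => (next (x i)).cost x + 1

/-- The height of a tree. -/
def height [Fintype A] : DecisionTree ι A O → ℕ
  | leaf _ => 0
  | query _ next => (Finset.univ.sup fun a => (next a).height) + 1

/-- No internal node is labelled by an element of `S` or by the label of an ancestor. -/
def Avoids : DecisionTree ι A O → Set ι → Prop
  | leaf _, _ => True
  | query i next, S => i ∉ S ∧ ∀ a, (next a).Avoids (insert i S)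

/-- No internal node shares its label with an ancestor. -/
def ReadOnce (D : DecisionTree ι A O) : Prop := D.Avoids ∅

end DecisionTree

/-- Randomised decision trees: probability distributions over deterministic decision trees
that never query the same position twice. -/
abbrev RandomisedTree (ι A O : Type*) := PMF {D : DecisionTree ι A O // D.ReadOnce}

/-- The domain of a relation: the inputs for which some output is valid. -/
def Dom (f : Set ((ι → A) × O)) : Set (ι → A) := {x | ∃ o, (x, o) ∈ f}

/-- `cost(R, x)`: the expected number of queries that `R` makes on input `x`. -/
noncomputable def cost (R : RandomisedTree ι A O) (x : ι → A) : ℝ≥0∞ :=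
  ∑' D, R D * (D.1.cost x : ℝ≥0∞)

/-- `err_f(R, x)`: the probability that the output of `R` on `x` is not valid for `f`. -/
noncomputable def err (f : Set ((ι → A) × O)) (R : RandomisedTree ι A O) (x : ι → A) : ℝ≥0∞ :=
  R.toOuterMeasure {D | (x, D.1.eval x) ∉ f}

/-- `bias_f(R, x) = max {1 - 2 err_f(R, x), 0}` (subtraction in `ℝ≥0∞` is truncated at `0`). -/
noncomputable def bias (f : Set ((ι → A) × O)) (R : RandomisedTree ι A O) (x : ι → A) : ℝ≥0∞ :=
  1 - 2 * err f R x

/-- `R` computes `f` to error `ε`. -/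
def Computes (f : Set ((ι → A) × O)) (ε : ℝ) (R : RandomisedTree ι A O) : Prop :=
  ∀ x ∈ Dom f, err f R x ≤ ENNReal.ofReal ε

/-- The worst-case `ε`-error randomised query complexity `R_ε(f)`: the least `T` for which some
randomised tree computes `f` to error `ε` with all trees in its support of height at most `T`. -/
noncomputable def worstCaseComplexity [Fintype A] (ε : ℝ) (f : Set ((ι → A) × O)) : ℝ≥0∞ :=
  ⨅ (T : ℕ) (_ : ∃ R : RandomisedTree ι A O,
    Computes f ε R ∧ ∀ D ∈ R.support, D.1.height ≤ T), (T : ℝ≥0∞)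

/-- The expected `ε`-error randomised query complexity `R̄_ε(f)`: the least value of
`max_{x ∈ Dom f} cost(R, x)` over the randomised trees that compute `f` to error `ε`. -/
noncomputable def expectedComplexity (ε : ℝ) (f : Set ((ι → A) × O)) : ℝ≥0∞ :=
  ⨅ (R : RandomisedTree ι A O) (_ : Computes f ε R), ⨆ x ∈ Dom f, cost R x

open Classical in
/-- The ratio `cost(R, x) / bias_g(R, x)`, equal to `∞` whenever the bias is `0` (also for
`0 / 0`, which differs from the convention of division in `ℝ≥0∞`). -/
noncomputable def costBiasRatio (g : (ι → A) →. Bool) (R : RandomisedTree ι A Bool)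
    (x : ι → A) : ℝ≥0∞ :=
  if bias g.graph R x = 0 then ⊤ else cost R x / bias g.graph R x

/-- The linearised randomised query complexity
`LR(g) = min_R max_{x ∈ Dom g} cost(R, x) / bias_g(R, x)`. -/
noncomputable def LR (g : (ι → A) →. Bool) : ℝ≥0∞ :=
  ⨅ R : RandomisedTree ι A Bool, ⨆ x ∈ g.Dom, costBiasRatio g R x

/-- The composition `f ∘ g`: on `x = (x¹, …, xⁿ)` with blocks `xⁱ = x (i, ·)`, the output `o` is
valid iff every `g(xⁱ)` is defined and `o` is valid for `f` on `(g(x¹), …, g(xⁿ))`. If `f` is the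
graph of a partial function, so is `f ∘ g`. -/
def comp {n m : ℕ} (f : Set ((Fin n → Bool) × O)) (g : (Fin m → A) →. Bool) :
    Set ((Fin n × Fin m → A) × O) :=
  {p | ∃ y : Fin n → Bool, (∀ i, y i ∈ g fun j => p.1 (i, j)) ∧ (y, p.2) ∈ f}

end QueryComplexity

/-! Fix `L < LR g`. A minimax argument, by Hahn–Banach separation, gives distributions μ₀ and μ₁ on
the 0- and 1-inputs of `g` such that guessing the bit with advantage δ costs at least `L * δ`, the
cost being weighted by μ₀ + μ₁ (`exists_hard_distributions`).

Take a randomised tree for `f ∘ g` and `y ∈ Dom f`. Filling block i with a sample from μ_{y i} makes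
the tree solve `f` on `y`, and the sample can be generated symbol by symbol without knowing `y i` at
first. As long as the weights of the set C of strings consistent with the answers are within a
factor of 3, answers are drawn from the part min(μ₀(C), μ₁(C)) common to both distributions; `y i`
is read when the sampling leaves this part. If that happened often, the bit could be guessed well by
stopping at the first imbalance and naming the likelier value. Wherever this guesser queries, μ₀(C)
+ μ₁(C) ≤ 4 μ_b(C) for both b, so hardness bounds the probability of reading the bit by `4 / L`
times the expected number of queries to the block (`one_le_leftover_add_cost`).

Hence, with weight 1 on bits and `4 / L` on block symbols, a block can be replaced by its bit
without raising the expected weight (`exists_bit_tree`). Doing this for all blocks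
(`exists_simulation`, `exists_outer_tree`) yields a tree for `f` with the same error and at most `4
/ L` times the expected cost. Letting L tend to `LR g` proves the second claim with 4 in place of 6.
For the first, truncation and a majority of three runs turn expected into worst-case cost at the
price of a factor 72, whence 288 = 4 · 72. -/

namespace QueryComplexity

/-! ## Expectations over probability mass functions -/

section Expectation

variable {α β : Type*}

/-- The expectation of a nonnegative function under a probability mass function. -/
noncomputable def expect (P : PMF α) (φ : α → ℝ≥0∞) : ℝ≥0∞ := ∑' a, P a * φ a

theorem expect_mono (P : PMF α) {φ ψ : α → ℝ≥0∞} (h : ∀ a ∈ P.support, φ a ≤ ψ a) :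
    expect P φ ≤ expect P ψ := by
  refine ENNReal.tsum_le_tsum fun a => ?_
  by_cases ha : P a = 0
  · simp [ha]
  · gcongr
    exact h a ha

theorem expect_add (P : PMF α) (φ ψ : α → ℝ≥0∞) :
    expect P (fun a => φ a + ψ a) = expect P φ + expect P ψ := by
  simp only [expect, mul_add, ENNReal.tsum_add]

theorem expect_const_mul (P : PMF α) (c : ℝ≥0∞) (φ : α → ℝ≥0∞) :
    expect P (fun a => c * φ a) = c * expect P φ := by
  simp only [expect, mul_left_comm _ c, ENNReal.tsum_mul_left]

theorem expect_mul_const (P : PMF α) (c : ℝ≥0∞) (φ : α → ℝ≥0∞) :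
    expect P (fun a => φ a * c) = expect P φ * c := by
  simp only [mul_comm _ c, expect_const_mul]

@[simp] theorem expect_const (P : PMF α) (c : ℝ≥0∞) : expect P (fun _ => c) = c := by
  simp [expect, ENNReal.tsum_mul_right]

@[simp] theorem expect_pure (a : α) (φ : α → ℝ≥0∞) : expect (PMF.pure a) φ = φ a := by
  rw [expect, tsum_eq_single a]
  · simp
  · intro b hb
    simp [PMF.pure_apply, hb]

theorem expect_bind (P : PMF α) (f : α → PMF β) (φ : β → ℝ≥0∞) :
    expect (P.bind f) φ = expect P (fun a => expect (f a) φ) := by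
  simp only [expect, PMF.bind_apply, ← ENNReal.tsum_mul_right, ← ENNReal.tsum_mul_left]
  rw [ENNReal.tsum_comm]
  simp only [mul_assoc]

theorem expect_map (P : PMF α) (f : α → β) (φ : β → ℝ≥0∞) :
    expect (P.map f) φ = expect P (fun a => φ (f a)) := by
  rw [PMF.map, expect_bind]
  simp

theorem expect_finset_sum {κ : Type*} (P : PMF α) (s : Finset κ) (φ : κ → α → ℝ≥0∞) :
    expect P (fun a => ∑ k ∈ s, φ k a) = ∑ k ∈ s, expect P (φ k) := by
  classical
  induction s using Finset.induction_on with
  | empty => simp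
  | insert k s hk ih => simp only [Finset.sum_insert hk, expect_add, ih]

/-- A finite mixture of probability mass functions, with weights that need not be normalised. -/
theorem exists_mixture [Fintype α] [Nonempty α] (w : α → ℝ≥0) (P : α → PMF β) :
    ∃ Q : PMF β, ∀ φ : β → ℝ≥0∞,
      ((∑ a, w a : ℝ≥0) : ℝ≥0∞) * expect Q φ = ∑ a, (w a : ℝ≥0∞) * expect (P a) φ := by
  by_cases h : ∑ a, w a = 0
  · refine ⟨P (Classical.arbitrary α), fun φ => ?_⟩
    have h' : ∀ a, w a = 0 := by simpa [Finset.sum_eq_zero_iff] using h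
    simp [h']
  · have hs : ∑' a, (w a : ℝ≥0∞) = ((∑ a, w a : ℝ≥0) : ℝ≥0∞) := by
      rw [tsum_fintype, ENNReal.ofNNReal_finsetSum]
    have h0 : ∑' a, (w a : ℝ≥0∞) ≠ 0 := by rw [hs]; exact_mod_cast h
    have hT : ∑' a, (w a : ℝ≥0∞) ≠ ∞ := by rw [hs]; exact ENNReal.coe_ne_top
    refine ⟨(PMF.normalize _ h0 hT).bind P, fun φ => ?_⟩
    rw [expect_bind, expect, tsum_fintype, Finset.mul_sum]
    refine Finset.sum_congr rfl fun a _ => ?_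
    rw [PMF.normalize_apply, ← mul_assoc, mul_left_comm, ← hs, ENNReal.mul_inv_cancel h0 hT, mul_one]

/-- A joint distribution with prescribed marginals. -/
theorem exists_joint [Finite α] (P : α → PMF β) :
    ∃ Q : PMF (α → β), ∀ a (φ : β → ℝ≥0∞), expect Q (fun F => φ (F a)) = expect (P a) φ := by
  classical
  cases nonempty_fintype α
  suffices h : ∀ s : Finset α, ∃ Q : PMF (α → β), ∀ a ∈ s, ∀ φ : β → ℝ≥0∞,
      expect Q (fun F => φ (F a)) = expect (P a) φ by
    obtain ⟨Q, hQ⟩ := h Finset.univ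
    exact ⟨Q, fun a => hQ a (Finset.mem_univ a)⟩
  intro s
  induction s using Finset.induction_on with
  | empty => exact ⟨PMF.pure fun a => (P a).support_nonempty.choose, by simp⟩
  | insert k s hk ih =>
    obtain ⟨Q, hQ⟩ := ih
    refine ⟨Q.bind fun F => (P k).map (Function.update F k), fun a ha φ => ?_⟩
    simp only [expect_bind, expect_map]
    by_cases hak : a = k
    · subst hak
      simp
    · simp only [Function.update_of_ne hak, expect_const]
      exact hQ a ((Finset.mem_insert.1 ha).resolve_left hak) φ

end Expectation

/-! ## Operations on decision trees -/

section Trees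

variable {ι A O : Type*}

theorem cost_eq_expect (R : RandomisedTree ι A O) (x : ι → A) :
    cost R x = expect R (fun D => (D.1.cost x : ℝ≥0∞)) := rfl

open Classical in
theorem err_eq_expect (f : Set ((ι → A) × O)) (R : RandomisedTree ι A O) (x : ι → A) :
    err f R x = expect R (fun D => if (x, D.1.eval x) ∈ f then 0 else 1) := by
  rw [err, PMF.toOuterMeasure_apply, expect]
  refine tsum_congr fun D => ?_
  by_cases h : (x, D.1.eval x) ∈ f <;> simp [Set.indicator, h]

namespace DecisionTree

theorem Avoids.mono {D : DecisionTree ι A O} : ∀ {S S' : Set ι}, S ⊆ S' → D.Avoids S' →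
    D.Avoids S := by
  induction D with
  | leaf o => intros; trivial
  | query i next ih =>
    intro S S' hS h
    exact ⟨fun hi => h.1 (hS hi), fun a => ih a (Set.insert_subset_insert hS) (h.2 a)⟩

open Classical in
/-- Remove repeated queries, given the answers `k` that are already known. -/
noncomputable def prune : DecisionTree ι A O → (ι → Option A) → DecisionTree ι A O
  | leaf o, _ => leaf o
  | query i next, k =>
    match k i with
    | some a => (next a).prune k
    | none => query i fun a => (next a).prune (Function.update k i (some a))

/-- Simulated and composed trees may repeat queries, which `RandomisedTree` forbids. The invariant
is that positions with a known answer are never queried again. -/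
theorem prune_avoids (D : DecisionTree ι A O) :
    ∀ k : ι → Option A, (D.prune k).Avoids {i | k i ≠ none} := by
  classical
  induction D with
  | leaf o => intro k; trivial
  | query i next ih =>
    intro k
    rw [prune]
    split
    next a ha => exact ih a k
    next ha =>
      refine ⟨by simp [ha], fun a => (ih a _).mono ?_⟩
      rintro j (rfl | hj)
      · simp
      · by_cases hji : j = i
        · subst hji; simp
        · simpa [Function.update_of_ne hji] using hj

theorem prune_eval_cost (D : DecisionTree ι A O) (x : ι → A) :
    ∀ k : ι → Option A, (∀ i a, k i = some a → x i = a) →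
      (D.prune k).eval x = D.eval x ∧ (D.prune k).cost x ≤ D.cost x := by
  classical
  induction D with
  | leaf o => intro k _; exact ⟨rfl, le_rfl⟩
  | query i next ih =>
    intro k hk
    rw [prune]
    split
    next a ha =>
      have := ih a k hk
      rw [eval, cost, hk i a ha]
      exact ⟨this.1, this.2.trans (Nat.le_succ _)⟩
    next ha =>
      have := ih (x i) (Function.update k i (some (x i))) fun j a hj => by
        by_cases hji : j = i
        · subst hji; simpa using hj
        · exact hk j a (by simpa [Function.update_of_ne hji] using hj)
      exact ⟨this.1, Nat.succ_le_succ this.2⟩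

theorem prune_height [Fintype A] (D : DecisionTree ι A O) :
    ∀ k : ι → Option A, (D.prune k).height ≤ D.height := by
  classical
  induction D with
  | leaf o => intro k; exact le_rfl
  | query i next ih =>
    intro k
    rw [prune]
    split
    next a ha =>
      refine (ih a k).trans (Nat.le_succ_of_le ?_)
      exact Finset.le_sup (f := fun a => (next a).height) (Finset.mem_univ a)
    next ha => exact Nat.succ_le_succ (Finset.sup_mono_fun fun a _ => ih a _)

/-- The read-once version of a decision tree. -/
noncomputable def toReadOnce (D : DecisionTree ι A O) : {D : DecisionTree ι A O // D.ReadOnce} :=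
  ⟨D.prune fun _ => none, (D.prune_avoids _).mono (Set.empty_subset _)⟩

theorem toReadOnce_eval (D : DecisionTree ι A O) (x : ι → A) : D.toReadOnce.1.eval x = D.eval x :=
  (D.prune_eval_cost x _ (by simp)).1

theorem toReadOnce_cost_le (D : DecisionTree ι A O) (x : ι → A) :
    D.toReadOnce.1.cost x ≤ D.cost x :=
  (D.prune_eval_cost x _ (by simp)).2

theorem toReadOnce_height_le [Fintype A] (D : DecisionTree ι A O) :
    D.toReadOnce.1.height ≤ D.height :=
  D.prune_height _

/-- Stop after `H` queries, with output `o`. -/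
def truncate (o : O) : ℕ → DecisionTree ι A O → DecisionTree ι A O
  | _, leaf o' => leaf o'
  | 0, query _ _ => leaf o
  | H + 1, query i next => query i fun a => truncate o H (next a)

theorem truncate_eval (o : O) (D : DecisionTree ι A O) (x : ι → A) :
    ∀ H, D.cost x ≤ H → (truncate o H D).eval x = D.eval x := by
  induction D with
  | leaf o' => intro H _; cases H <;> rfl
  | query i next ih =>
    intro H hH
    cases H with
    | zero => simp [cost] at hH
    | succ H => exact ih _ H (Nat.le_of_succ_le_succ hH)

theorem truncate_height_le [Fintype A] (o : O) (D : DecisionTree ι A O) :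
    ∀ H, (truncate o H D).height ≤ H := by
  induction D with
  | leaf o' => intro H; cases H <;> exact Nat.zero_le _
  | query i next ih =>
    intro H
    cases H with
    | zero => exact le_rfl
    | succ H => exact Nat.succ_le_succ (Finset.sup_le fun a _ => ih a H)

/-- Run a further tree at each leaf. -/
def bind {O' : Type*} : DecisionTree ι A O → (O → DecisionTree ι A O') → DecisionTree ι A O'
  | leaf o, E => E o
  | query i next, E => query i fun a => (next a).bind E

theorem bind_eval {O' : Type*} (D : DecisionTree ι A O) (E : O → DecisionTree ι A O')
    (x : ι → A) : (D.bind E).eval x = (E (D.eval x)).eval x := by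
  induction D with
  | leaf o => rfl
  | query i next ih => exact ih _

theorem bind_height_le [Fintype A] {O' : Type*} (D : DecisionTree ι A O)
    (E : O → DecisionTree ι A O') {h : ℕ} (hE : ∀ o, (E o).height ≤ h) :
    (D.bind E).height ≤ D.height + h := by
  induction D with
  | leaf o => simpa [bind, height] using hE o
  | query i next ih =>
    rw [bind, height, height, Nat.add_right_comm]
    refine Nat.succ_le_succ (Finset.sup_le fun a _ => (ih a).trans ?_)
    gcongr
    exact Finset.le_sup (f := fun a => (next a).height) (Finset.mem_univ a)

/-- The total weight of the queries made on input `x`, if a query of `i` has weight `c i`. -/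
noncomputable def weightedCost (c : ι → ℝ≥0∞) : DecisionTree ι A O → (ι → A) → ℝ≥0∞
  | leaf _, _ => 0
  | query i next, x => (next (x i)).weightedCost c x + c i

end DecisionTree

end Trees

end QueryComplexity

namespace QueryComplexity

/-! ## Simulating one block

A block of positions `J` holds a random string drawn from `μ b`, where `b` is a hidden bit. A
decision tree that reads the block is simulated by a randomised tree that reads only `b`, and
that reads it as late as possible: after the block has been restricted to a set `C` of strings, the
bit is still unread with probability proportional to `min (mass μ false C) (mass μ true C)`, unless
one of the two values of `b` has become much more likely than the other, when `b` is read. -/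

section Block

variable {J A O : Type*}

/-- The weight of a set of strings under `μ b`. -/
noncomputable def mass (μ : Bool → (J → A) → ℝ≥0) (b : Bool) (C : Finset (J → A)) : ℝ≥0 :=
  ∑ x ∈ C, μ b x

/-- The two weights of `C` differ at most by a factor of `3`. -/
def Balanced (μ : Bool → (J → A) → ℝ≥0) (C : Finset (J → A)) : Prop :=
  mass μ true C ≤ 3 * mass μ false C ∧ mass μ false C ≤ 3 * mass μ true C

open Classical in
/-- The strings in `C` with symbol `a` at position `j`. -/
noncomputable def child (C : Finset (J → A)) (j : J) (a : A) : Finset (J → A) :=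
  C.filter fun x => x j = a

theorem sum_child [Fintype A] {M : Type*} [AddCommMonoid M] (C : Finset (J → A)) (j : J)
    (φ : (J → A) → M) : ∑ a, ∑ x ∈ child C j a, φ x = ∑ x ∈ C, φ x := by
  classical
  unfold child
  convert Finset.sum_fiberwise C (fun x => x j) φ

theorem sum_child_apply [Fintype A] {M : Type*} [AddCommMonoid M] (C : Finset (J → A)) (j : J)
    (φ : A → (J → A) → M) : ∑ a, ∑ x ∈ child C j a, φ a x = ∑ x ∈ C, φ (x j) x := by
  classical
  rw [← sum_child C j]
  refine Finset.sum_congr rfl fun a _ => Finset.sum_congr rfl fun x hx => ?_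
  rw [(Finset.mem_filter.1 hx).2]

theorem sum_mass_child [Fintype A] (μ : Bool → (J → A) → ℝ≥0) (b : Bool) (C : Finset (J → A))
    (j : J) : ∑ a, mass μ b (child C j a) = mass μ b C :=
  sum_child C j _

/-- The probability that the block lies in `C` and the hidden bit has not been read. -/
noncomputable def unread (μ : Bool → (J → A) → ℝ≥0) (C : Finset (J → A)) (alive : Bool) : ℝ≥0 :=
  if alive then min (mass μ false C) (mass μ true C) else 0

open Classical in
/-- Whether the simulation may continue without reading the bit when the block lies in `C`. -/
noncomputable def stillAlive (μ : Bool → (J → A) → ℝ≥0) (C : Finset (J → A)) (alive : Bool) :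
    Bool :=
  alive && decide (Balanced μ C)

/-- This makes every truncated difference `mass - unread` a genuine one: it is the probability, for
hidden bit `b`, that the block lies in `C` and the bit has been read. -/
theorem unread_le_mass (μ : Bool → (J → A) → ℝ≥0) (C : Finset (J → A)) (alive b : Bool) :
    unread μ C alive ≤ mass μ b C := by
  unfold unread
  split
  · cases b
    · exact min_le_left _ _
    · exact min_le_right _ _
  · exact zero_le

/-- A sum of minima is at most the minimum of the sums. The deficit is the probability that the bit
is read at this query. -/
theorem sum_unread_child_le [Fintype A] (μ : Bool → (J → A) → ℝ≥0) (C : Finset (J → A))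
    (alive : Bool) (j : J) :
    ∑ a, unread μ (child C j a) (stillAlive μ (child C j a) alive) ≤ unread μ C alive := by
  have h : ∀ b, ∑ a, unread μ (child C j a) (stillAlive μ (child C j a) alive) ≤ mass μ b C :=
    fun b => (Finset.sum_le_sum fun a _ => unread_le_mass _ _ _ b).trans_eq
      (sum_mass_child μ b C j)
  cases alive with
  | false => simp [unread, stillAlive]
  | true => exact le_min (h false) (h true)

/-- The probability that a tree has been simulated without reading the bit. -/
noncomputable def leftover [Fintype A] (μ : Bool → (J → A) → ℝ≥0) :
    DecisionTree J A O → Finset (J → A) → Bool → ℝ≥0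
  | .leaf _, C, alive => unread μ C alive
  | .query j next, C, alive =>
    ∑ a, leftover μ (next a) (child C j a) (stillAlive μ (child C j a) alive)

theorem leftover_dead [Fintype A] (μ : Bool → (J → A) → ℝ≥0) (E : DecisionTree J A O) :
    ∀ C, leftover μ E C false = 0 := by
  induction E with
  | leaf o => intro C; simp [leftover, unread]
  | query j next ih => intro C; simp [leftover, stillAlive, ih]

open Classical in
/-- Run a tree until the two values of the bit become unbalanced, then guess the bit. -/
noncomputable def guess (μ : Bool → (J → A) → ℝ≥0) :
    DecisionTree J A O → Finset (J → A) → DecisionTree J A Bool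
  | .leaf _, C => .leaf (decide (mass μ false C ≤ mass μ true C))
  | .query j next, C =>
    if Balanced μ C then .query j fun a => guess μ (next a) (child C j a)
    else .leaf (decide (mass μ false C ≤ mass μ true C))

/-- The advantage of a tree in guessing the bit, on strings from `C`. -/
noncomputable def advantage (μ : Bool → (J → A) → ℝ≥0) (t : DecisionTree J A Bool)
    (C : Finset (J → A)) : ℝ :=
  ∑ x ∈ C, ((μ (t.eval x) x : ℝ) - μ (!t.eval x) x)

theorem advantage_leaf (μ : Bool → (J → A) → ℝ≥0) (b : Bool) (C : Finset (J → A)) :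
    advantage μ (.leaf b) C = mass μ b C - mass μ (!b) C := by
  simp [advantage, DecisionTree.eval, mass, Finset.sum_sub_distrib]

theorem advantage_query [Fintype A] (μ : Bool → (J → A) → ℝ≥0) (j : J)
    (next : A → DecisionTree J A Bool) (C : Finset (J → A)) :
    advantage μ (.query j next) C = ∑ a, advantage μ (next a) (child C j a) := by
  unfold advantage
  rw [sum_child_apply C j fun a x =>
    ((μ ((next a).eval x) x : ℝ) - μ (!(next a).eval x) x)]
  rfl

theorem advantage_guess_leaf (μ : Bool → (J → A) → ℝ≥0) (C : Finset (J → A)) :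
    advantage μ (.leaf (decide (mass μ false C ≤ mass μ true C))) C =
      |(mass μ true C : ℝ) - mass μ false C| := by
  rw [advantage_leaf]
  by_cases h : mass μ false C ≤ mass μ true C
  · have h' : (mass μ false C : ℝ) ≤ mass μ true C := by exact_mod_cast h
    simp [h, abs_of_nonneg (sub_nonneg.2 h')]
  · have h' : (mass μ true C : ℝ) ≤ mass μ false C := by exact_mod_cast (not_le.1 h).le
    simp [h, abs_of_nonpos (sub_nonpos.2 h')]

/-- Here the ratio 3 enters: a ≥ 3b is equivalent to a + b ≤ 2(a - b). -/
theorem mass_le_of_not_balanced {μ : Bool → (J → A) → ℝ≥0} {C : Finset (J → A)}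
    (h : ¬Balanced μ C) :
    (mass μ false C + mass μ true C : ℝ) ≤ 2 * |(mass μ true C : ℝ) - mass μ false C| := by
  rw [Balanced, not_and_or, not_le, not_le, ← NNReal.coe_lt_coe, ← NNReal.coe_lt_coe] at h
  push_cast at h
  have h0 := (mass μ false C).coe_nonneg
  have h1 := (mass μ true C).coe_nonneg
  rcases h with h | h
  · linarith [le_abs_self ((mass μ true C : ℝ) - mass μ false C)]
  · linarith [neg_abs_le ((mass μ true C : ℝ) - mass μ false C)]

/-- Both sides add up over the children of a balanced node, so only the stopping points matter. At a
balanced leaf a + b = 2 min(a, b) + |a - b|; at an unbalanced node nothing is left over and the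
guess alone pays for the mass. -/
theorem mass_le_leftover_add_advantage [Fintype A] (μ : Bool → (J → A) → ℝ≥0)
    (E : DecisionTree J A O) : ∀ C,
    (mass μ false C + mass μ true C : ℝ) ≤
      2 * leftover μ E C (stillAlive μ C true) + 2 * advantage μ (guess μ E C) C := by
  classical
  induction E with
  | leaf o =>
    intro C
    rw [guess, advantage_guess_leaf, leftover, stillAlive, Bool.true_and]
    by_cases hC : Balanced μ C
    · simp only [hC, decide_true, unread, if_true, NNReal.coe_min]
      rcases le_total (mass μ false C : ℝ) (mass μ true C) with h | h
      · rw [min_eq_left h, abs_of_nonneg (sub_nonneg.2 h)]; linarith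
      · rw [min_eq_right h, abs_of_nonpos (sub_nonpos.2 h)]; linarith
    · have := mass_le_of_not_balanced hC
      simpa [hC, unread] using this
  | query j next ih =>
    intro C
    by_cases hC : Balanced μ C
    · have hs : stillAlive μ C true = true := by simp [stillAlive, hC]
      rw [guess, if_pos hC, advantage_query, leftover, hs, NNReal.coe_sum, Finset.mul_sum,
        Finset.mul_sum, ← Finset.sum_add_distrib, ← sum_mass_child μ false C j,
        ← sum_mass_child μ true C j, NNReal.coe_sum, NNReal.coe_sum, ← Finset.sum_add_distrib]
      exact Finset.sum_le_sum fun a _ => ih a _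
    · have hs : stillAlive μ C true = false := by simp [stillAlive, hC]
      rw [guess, if_neg hC, advantage_guess_leaf, hs, leftover_dead]
      simpa using mass_le_of_not_balanced hC

theorem sum_query_cost [Fintype A] (ν : (J → A) → ℝ) (j : J) (next : A → DecisionTree J A O)
    (C : Finset (J → A)) :
    ∑ x ∈ C, ν x * ((DecisionTree.query j next).cost x : ℝ) =
      ∑ a, ∑ x ∈ child C j a, ν x * ((next a).cost x : ℝ) + ∑ x ∈ C, ν x := by
  rw [sum_child_apply C j fun a x => ν x * ((next a).cost x : ℝ), ← Finset.sum_add_distrib]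
  refine Finset.sum_congr rfl fun x _ => ?_
  rw [DecisionTree.cost]
  push_cast
  ring

/-- The guesser queries only at balanced nodes, where the mass of either value of the bit is at
least a quarter of the total. -/
theorem sum_cost_guess_le [Fintype A] (μ : Bool → (J → A) → ℝ≥0) (b : Bool)
    (E : DecisionTree J A O) : ∀ C,
    ∑ x ∈ C, ((μ false x : ℝ) + μ true x) * ((guess μ E C).cost x : ℝ) ≤
      4 * ∑ x ∈ C, (μ b x : ℝ) * (E.cost x : ℝ) := by
  classical
  induction E with
  | leaf o => intro C; simp [guess, DecisionTree.cost]
  | query j next ih =>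
    intro C
    by_cases hC : Balanced μ C
    · rw [guess, if_pos hC, sum_query_cost (fun x => (μ false x : ℝ) + μ true x),
        sum_query_cost (fun x => (μ b x : ℝ)), mul_add, Finset.mul_sum]
      refine add_le_add (Finset.sum_le_sum fun a _ => ih a _) ?_
      have h1 : (mass μ true C : ℝ) ≤ 3 * mass μ false C := by exact_mod_cast hC.1
      have h2 : (mass μ false C : ℝ) ≤ 3 * mass μ true C := by exact_mod_cast hC.2
      simp only [mass, NNReal.coe_sum] at h1 h2
      rw [Finset.sum_add_distrib]
      cases b <;> linarith
    · rw [guess, if_neg hC]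
      simp only [DecisionTree.cost, Nat.cast_zero, mul_zero, Finset.sum_const_zero]
      positivity

/-- If guessing the bit with advantage `δ` costs at least `L * δ`, then the simulation reads the bit
with probability at most `4 / L` times the cost of the simulated tree. -/
theorem one_le_leftover_add_cost [Fintype A] [Fintype J] [DecidableEq J]
    {μ : Bool → (J → A) → ℝ≥0} (hμ : ∀ b, ∑ x, μ b x = 1) {L : ℝ≥0} (hL : 0 < L)
    (hard : ∀ t : DecisionTree J A Bool, L * advantage μ t Finset.univ ≤
      ∑ x, ((μ false x : ℝ) + μ true x) * (t.cost x : ℝ))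
    (E : DecisionTree J A O) (b : Bool) :
    1 ≤ leftover μ E Finset.univ true + 4 / L * ∑ x, μ b x * (E.cost x : ℝ≥0) := by
  classical
  have hm : ∀ b, mass μ b Finset.univ = 1 := hμ
  have hs : stillAlive μ Finset.univ true = true := by
    have : (1 : ℝ≥0) ≤ 3 := by norm_num
    simp [stillAlive, Balanced, hm, this]
  have h1 := mass_le_leftover_add_advantage μ E Finset.univ
  have h2 := hard (guess μ E Finset.univ)
  have h3 := sum_cost_guess_le μ b E Finset.univ
  rw [hs, hm, hm] at h1
  rw [← NNReal.coe_le_coe]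
  push_cast at h1 ⊢
  have hL' : (0 : ℝ) < L := by exact_mod_cast hL
  set S : ℝ := ∑ x, (μ b x : ℝ) * (E.cost x : ℝ)
  have h4 : advantage μ (guess μ E Finset.univ) Finset.univ ≤ 4 / L * S := by
    rw [div_mul_eq_mul_div, le_div_iff₀ hL']
    linarith
  linarith

end Block

end QueryComplexity

namespace QueryComplexity

/-! ### Replacing one block by one hidden bit -/

section Simulation

variable {ι Γ J A O : Type*}

/-- The input `z` with the positions of the block replaced by the string `x`. -/
def overwrite (blk : ι → Option J) (emb : A → Γ) (z : ι → Γ) (x : J → A) : ι → Γ := fun p =>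
  match blk p with
  | some j => emb (x j)
  | none => z p

theorem overwrite_some {blk : ι → Option J} {p : ι} {j : J} (h : blk p = some j) (emb : A → Γ)
    (z : ι → Γ) (x : J → A) : overwrite blk emb z x p = emb (x j) := by
  simp [overwrite, h]

theorem overwrite_none {blk : ι → Option J} {p : ι} (h : blk p = none) (emb : A → Γ)
    (z : ι → Γ) (x : J → A) : overwrite blk emb z x p = z p := by
  simp [overwrite, h]

/-- The tree on the block that remains when the input outside of the block is fixed to `z`. -/
def restrict (blk : ι → Option J) (emb : A → Γ) : DecisionTree ι Γ O → (ι → Γ) →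
    DecisionTree J A O
  | .leaf o, _ => .leaf o
  | .query p next, z =>
    match blk p with
    | some j => .query j fun a => restrict blk emb (next (emb a)) z
    | none => restrict blk emb (next (z p)) z

theorem restrict_query_some {blk : ι → Option J} {p : ι} {j : J} (h : blk p = some j)
    (emb : A → Γ) (next : Γ → DecisionTree ι Γ O) (z : ι → Γ) :
    restrict blk emb (.query p next) z = .query j fun a => restrict blk emb (next (emb a)) z := by
  rw [restrict, h]

theorem restrict_query_none {blk : ι → Option J} {p : ι} (h : blk p = none)
    (emb : A → Γ) (next : Γ → DecisionTree ι Γ O) (z : ι → Γ) :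
    restrict blk emb (.query p next) z = restrict blk emb (next (z p)) z := by
  rw [restrict, h]

/-- The weights of the queries outside of the block. -/
def outerWeight (blk : ι → Option J) (c : ι → ℝ≥0∞) : ι → ℝ≥0∞ := fun p =>
  if (blk p).isSome then 0 else c p

/-- Separates the block queries, which form a tree on the block alone to which the hardness bound
applies, from the outer queries, which the simulation copies. -/
theorem weightedCost_overwrite {blk : ι → Option J} {c : ι → ℝ≥0∞} {w : ℝ≥0∞}
    (hc : ∀ p, (blk p).isSome → c p = w) (emb : A → Γ) (D : DecisionTree ι Γ O) (z : ι → Γ)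
    (x : J → A) :
    D.weightedCost c (overwrite blk emb z x) =
      D.weightedCost (outerWeight blk c) (overwrite blk emb z x) +
        w * (restrict blk emb D z).cost x := by
  induction D with
  | leaf o => simp [DecisionTree.weightedCost, restrict, DecisionTree.cost]
  | query p next ih =>
    rw [DecisionTree.weightedCost, DecisionTree.weightedCost, ih]
    cases h : blk p with
    | none =>
      rw [restrict_query_none h, overwrite_none h]
      simp only [outerWeight, h, Option.isSome_none, Bool.false_eq_true, if_false]
      ring
    | some j =>
      rw [restrict_query_some h, overwrite_some h, DecisionTree.cost, hc p (by simp [h])]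
      simp only [outerWeight, h, Option.isSome_some, if_true]
      push_cast
      ring

/-- The simulation of a block that has been restricted to `C`: the tree `U` is used as long as the
bit at position `i₀` has not been read, and the tree `V b` once it has been found to be `b`. -/
theorem exists_block_simulation [Fintype A] [Finite Γ] (blk : ι → Option J) (emb : A → Γ)
    (bit : Γ → Bool) (i₀ : ι) {c : ι → ℝ≥0∞} (hc : c i₀ = 1) (μ : Bool → (J → A) → ℝ≥0)
    (x₀ : J → A) (D : DecisionTree ι Γ O) : ∀ (C : Finset (J → A)) (alive : Bool),
    ∃ (U : PMF (DecisionTree ι Γ O)) (V : Bool → PMF (DecisionTree ι Γ O)), ∀ z : ι → Γ,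
      (∀ φ : O → ℝ≥0∞,
        unread μ C alive * expect U (fun T => φ (T.eval z)) +
          (mass μ (bit (z i₀)) C - unread μ C alive : ℝ≥0) *
            expect (V (bit (z i₀))) (fun T => φ (T.eval z)) =
        ∑ x ∈ C, μ (bit (z i₀)) x * φ (D.eval (overwrite blk emb z x))) ∧
      unread μ C alive * expect U (fun T => T.weightedCost c z) +
          (mass μ (bit (z i₀)) C - unread μ C alive : ℝ≥0) *
            expect (V (bit (z i₀))) (fun T => T.weightedCost c z) +
          leftover μ (restrict blk emb D z) C alive ≤
        ∑ x ∈ C, μ (bit (z i₀)) x *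
          D.weightedCost (outerWeight blk c) (overwrite blk emb z x) + unread μ C alive := by
  -- The first invariant says that outputs have exactly the right law. In the second, the
  -- probability of reading the bit below this node is charged to the drop from `unread` to
  -- `leftover`.
  induction D with
  | leaf o =>
    intro C alive
    refine ⟨PMF.pure (.leaf o), fun _ => PMF.pure (.leaf o), fun z => ⟨fun φ => ?_, ?_⟩⟩
    · simp only [expect_pure, DecisionTree.eval]
      rw [← add_mul, ← ENNReal.coe_add, add_tsub_cancel_of_le (unread_le_mass _ _ _ _), mass,
        ENNReal.ofNNReal_finsetSum, Finset.sum_mul]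
    · simp [DecisionTree.weightedCost, restrict, leftover]
  | query p next ih =>
    intro C alive
    cases h : blk p with
    -- An outer query is copied. Its answer selects the continuation, so the laws for the different
    -- answers are first combined into one law on families of trees.
    | none =>
      choose U V hUV using fun γ => ih γ C alive
      obtain ⟨QU, hQU⟩ := exists_joint U
      choose QV hQV using fun b => exists_joint fun γ => V γ b
      refine ⟨QU.map (.query p), fun b => (QV b).map (.query p), fun z => ?_⟩
      obtain ⟨h1, h2⟩ := hUV (z p) z
      simp only [expect_map, DecisionTree.eval, DecisionTree.weightedCost, overwrite_none h,
        restrict_query_none h, expect_add, expect_const]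
      constructor
      · intro φ
        rw [hQU (z p) fun T => φ (T.eval z), hQV _ (z p) fun T => φ (T.eval z)]
        exact h1 φ
      · rw [hQU (z p) fun T => T.weightedCost c z, hQV _ (z p) fun T => T.weightedCost c z]
        have hp : outerWeight blk c p = c p := by simp [outerWeight, h]
        have hM : ∑ x ∈ C, (μ (bit (z i₀)) x : ℝ≥0∞) * c p = unread μ C alive * c p +
            (mass μ (bit (z i₀)) C - unread μ C alive : ℝ≥0) * c p := by
          rw [← add_mul, ← ENNReal.coe_add, add_tsub_cancel_of_le (unread_le_mass _ _ _ _), mass,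
            ENNReal.ofNNReal_finsetSum, Finset.sum_mul]
        simp only [hp, mul_add, Finset.sum_add_distrib, hM]
        calc _ = (unread μ C alive * expect (U (z p)) (fun T => T.weightedCost c z) +
              (mass μ (bit (z i₀)) C - unread μ C alive : ℝ≥0) *
                expect (V (z p) (bit (z i₀))) (fun T => T.weightedCost c z) +
              leftover μ (restrict blk emb (next (z p)) z) C alive) +
              (unread μ C alive * c p +
                (mass μ (bit (z i₀)) C - unread μ C alive : ℝ≥0) * c p) := by ring
          _ ≤ _ := add_le_add_left h2 _
          _ = _ := by ring
    | some j =>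
      have : Nonempty A := ⟨x₀ j⟩
      set C' : A → Finset (J → A) := child C j with hC'
      set al : A → Bool := fun a => stillAlive μ (C' a) alive with hal
      choose U V hUV using fun a => ih (emb a) (C' a) (al a)
      set u := unread μ C alive with hu
      set u' : A → ℝ≥0 := fun a => unread μ (C' a) (al a) with hu'
      set q : Bool → A → ℝ≥0 := fun b a => mass μ b (C' a) - u' a with hq
      have hsum : ∑ a, u' a ≤ u := sum_unread_child_le μ C alive j
      -- `ν` is the probability of reading the bit now. Afterwards the mass with a read bit is `ν`
      -- plus the old `mass μ b C - u`, and it is distributed over the answers `a` by `q b`.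
      set ν := u - ∑ a, u' a with hν
      have hν' : ∑ a, u' a + ν = u := add_tsub_cancel_of_le hsum
      have hqs : ∀ b, ∑ a, q b a = ν + (mass μ b C - u) := by
        intro b
        have h1 : ∑ a, u' a + ∑ a, q b a = mass μ b C := by
          rw [← Finset.sum_add_distrib, ← sum_mass_child μ b C j]
          exact Finset.sum_congr rfl fun a _ => add_tsub_cancel_of_le (unread_le_mass _ _ _ _)
        have h2 : ∑ a, u' a + (ν + (mass μ b C - u)) = mass μ b C := by
          rw [← add_assoc, hν', add_tsub_cancel_of_le (unread_le_mass _ _ _ _)]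
        exact add_left_cancel (h1.trans h2.symm)
      choose W hW using fun b => exists_mixture (q b) fun a => V a b
      obtain ⟨QW, hQW⟩ := exists_joint W
      -- With weight `u' a` the answer is `a` and the bit stays unread. With weight `ν` the bit is
      -- queried and the run continues by `W b`, which also serves runs where it was already known.
      obtain ⟨X, hX⟩ := exists_mixture (fun o : Option A => o.elim ν u')
        (fun o => o.elim (QW.map fun F => DecisionTree.query i₀ fun γ => F (bit γ)) U)
      have hXs : ∑ o : Option A, o.elim ν u' = u := by
        rw [Fintype.sum_option, ← hν', add_comm]
        rfl
      -- The term `e` is the price of reading the bit: 0 when `φ` depends only on the output, 1 when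
      -- it is the weighted cost.
      have key : ∀ (b : Bool) (φ : DecisionTree ι Γ O → ℝ≥0∞) (e : ℝ≥0∞),
          expect QW (fun F => φ (.query i₀ fun γ => F (bit γ))) = expect (W b) φ + e →
          u * expect X φ + (mass μ b C - u : ℝ≥0) * expect (W b) φ =
            ∑ a, (u' a * expect (U a) φ + q b a * expect (V a b) φ) + ν * e := by
        intro b φ e he
        have h1 := hX φ
        have h2 := hW b φ
        simp only [hXs] at h1
        rw [Fintype.sum_option] at h1
        simp only [Option.elim_none, Option.elim_some, expect_map, he] at h1
        rw [h1, Finset.sum_add_distrib, ← h2, hqs]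
        push_cast
        ring
      refine ⟨X, W, fun z => ⟨fun φ => ?_, ?_⟩⟩
      · have he : expect QW (fun F => φ ((DecisionTree.query i₀ fun γ => F (bit γ)).eval z)) =
            expect (W (bit (z i₀))) (fun T => φ (T.eval z)) + 0 := by
          rw [add_zero]
          exact hQW (bit (z i₀)) fun T => φ (T.eval z)
        rw [key (bit (z i₀)) (fun T => φ (T.eval z)) 0 he, mul_zero, add_zero]
        simp only [DecisionTree.eval, overwrite_some h]
        rw [← sum_child_apply C j fun a x =>
          (μ (bit (z i₀)) x : ℝ≥0∞) * φ ((next (emb a)).eval (overwrite blk emb z x))]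
        exact Finset.sum_congr rfl fun a _ => (hUV a z).1 φ
      · have he : expect QW (fun F =>
              (DecisionTree.query i₀ fun γ => F (bit γ)).weightedCost c z) =
            expect (W (bit (z i₀))) (fun T => T.weightedCost c z) + 1 := by
          simp only [DecisionTree.weightedCost, expect_add, expect_const, hc]
          rw [hQW (bit (z i₀)) fun T => T.weightedCost c z]
        rw [key (bit (z i₀)) (fun T => T.weightedCost c z) 1 he, mul_one]
        have hp : outerWeight blk c p = 0 := by simp [outerWeight, h]
        simp only [DecisionTree.weightedCost, overwrite_some h, hp, add_zero,
          restrict_query_some h, leftover]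
        rw [← sum_child_apply C j fun a x => (μ (bit (z i₀)) x : ℝ≥0∞) *
            (next (emb a)).weightedCost (outerWeight blk c) (overwrite blk emb z x), ← hν',
          ENNReal.coe_add, ENNReal.ofNNReal_finsetSum, ENNReal.ofNNReal_finsetSum, ← add_assoc,
          add_right_comm, ← Finset.sum_add_distrib, ← Finset.sum_add_distrib]
        exact add_le_add_left (Finset.sum_le_sum fun a _ => (hUV a z).2) _

/-- One block of a randomised tree can be replaced by a single bit, if a query of the bit weighs `1`
and a query to the block weighs at least the probability with which it reveals the bit. -/
theorem exists_bit_tree [Fintype A] [Fintype J] [DecidableEq J] [Finite Γ]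
    (blk : ι → Option J) (emb : A → Γ) (bit : Γ → Bool) (i₀ : ι) {c : ι → ℝ≥0∞} (hc : c i₀ = 1)
    {w : ℝ≥0} (hw : ∀ p, (blk p).isSome → c p = w)
    {μ : Bool → (J → A) → ℝ≥0} (hμ : ∀ b, ∑ x, μ b x = 1)
    (hread : ∀ (E : DecisionTree J A O) (b : Bool),
      1 ≤ leftover μ E Finset.univ true + w * ∑ x, μ b x * (E.cost x : ℝ≥0))
    (R : PMF (DecisionTree ι Γ O)) :
    ∃ R' : PMF (DecisionTree ι Γ O), ∀ z : ι → Γ,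
      (∀ φ : O → ℝ≥0∞, expect R' (fun T => φ (T.eval z)) =
        ∑ x, μ (bit (z i₀)) x * expect R (fun D => φ (D.eval (overwrite blk emb z x)))) ∧
      expect R' (fun T => T.weightedCost c z) ≤
        ∑ x, μ (bit (z i₀)) x *
          expect R (fun D => D.weightedCost c (overwrite blk emb z x)) := by
  obtain ⟨x₀⟩ : Nonempty (J → A) := by
    by_contra hne
    rw [not_nonempty_iff] at hne
    simpa using hμ true
  -- At the start all mass is unread, so the trees `V` receive weight 0 and only `U` remains.
  have hu : unread μ Finset.univ true = 1 := by simp [unread, mass, hμ]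
  choose U V hUV using fun D : DecisionTree ι Γ O =>
    exists_block_simulation blk emb bit i₀ hc μ x₀ D Finset.univ true
  simp only [hu, mass, hμ, tsub_self, ENNReal.coe_zero, zero_mul, add_zero, ENNReal.coe_one,
    one_mul] at hUV
  refine ⟨R.bind U, fun z => ⟨fun φ => ?_, ?_⟩⟩
  · simp only [expect_bind, (hUV _ z).1 φ, expect_finset_sum, expect_const_mul]
  · simp only [expect_bind, ← expect_const_mul, ← expect_finset_sum]
    refine expect_mono R fun D _ => ?_
    have h1 := (hUV D z).2
    have h2 : (1 : ℝ≥0∞) ≤ leftover μ (restrict blk emb D z) Finset.univ true +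
        w * ∑ x, μ (bit (z i₀)) x * ((restrict blk emb D z).cost x : ℝ≥0∞) := by
      exact_mod_cast hread (restrict blk emb D z) (bit (z i₀))
    simp only [weightedCost_overwrite hw, mul_add, Finset.sum_add_distrib]
    simp only [mul_left_comm _ (w : ℝ≥0∞), ← Finset.mul_sum]
    refine (ENNReal.add_le_add_iff_right (a := leftover μ (restrict blk emb D z) Finset.univ true)
      ENNReal.coe_ne_top).1 (h1.trans ?_)
    calc _ ≤ _ := add_le_add_right h2 _
      _ = _ := by ring

end Simulation

end QueryComplexity

namespace QueryComplexity

/-! ## A hard distribution for the linearised complexity -/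

/-- `K` misses the open convex cone of functions that are negative on `S`. The coefficients of a
separating functional are the weights: nonnegativity comes from the cone, and vanishing off `S` from
the absence of constraints there. -/
theorem exists_nonneg_weights {X : Type*} [Fintype X] {S : Set X} {K : Set (X → ℝ)}
    (hK : Convex ℝ K) (hne : K.Nonempty) (h : ∀ p ∈ K, ∃ x ∈ S, 0 ≤ p x) :
    ∃ α : X → ℝ, (∀ x, 0 ≤ α x) ∧ (∀ x ∉ S, α x = 0) ∧ 0 < ∑ x, α x ∧
      ∀ p ∈ K, 0 ≤ ∑ x, α x * p x := by
  classical
  set N : Set (X → ℝ) := {p | ∀ x ∈ S, p x < 0} with hN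
  have hNeq : N = ⋂ x ∈ S, {p : X → ℝ | p x < 0} := by ext; simp [hN]
  have hNo : IsOpen N := by
    rw [hNeq]
    exact S.toFinite.isOpen_biInter fun x _ => isOpen_lt (continuous_apply x) continuous_const
  have hNc : Convex ℝ N := by
    intro p hp q hq a b ha hb hab x hx
    have h1 := hp x hx
    have h2 := hq x hx
    simp only [Pi.add_apply, Pi.smul_apply, smul_eq_mul]
    rcases ha.eq_or_lt with rfl | ha
    · have : b = 1 := by linarith
      subst this
      linarith
    · nlinarith
  have hd : Disjoint N K := by
    rw [Set.disjoint_left]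
    intro p hp hpK
    obtain ⟨x, hx, hx'⟩ := h p hpK
    exact absurd (hp x hx) (not_lt.2 hx')
  obtain ⟨f, u, hfN, hfK⟩ := geometric_hahn_banach_open hNc hNo hK hd
  have hsmul : ∀ p ∈ N, ∀ t : ℝ, 0 < t → t * f p < u := by
    intro p hp t ht
    have := hfN (t • p) fun x hx => mul_neg_of_pos_of_neg ht (hp x hx)
    simpa using this
  have hone : (fun _ => -1 : X → ℝ) ∈ N := fun x _ => by norm_num
  -- Scaling a point of the cone `N` towards 0 brings the functional arbitrarily close to 0, which a
  -- negative bound `u` would exclude; scaling it up then gives `hneg`.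
  have hu : 0 ≤ u := by
    by_contra hu
    push Not at hu
    have h1 := hsmul _ hone 1 one_pos
    set s := f fun _ => -1
    have hs : s < 0 := by linarith
    have h2 := hsmul _ hone (u / (2 * s)) (div_pos_of_neg_of_neg hu (by linarith))
    rw [div_mul_eq_mul_div, mul_div_mul_right _ _ hs.ne] at h2
    linarith
  have hneg : ∀ p ∈ N, f p ≤ 0 := by
    intro p hp
    by_contra hp0
    push Not at hp0
    have := hsmul p hp ((u + 1) / f p) (by positivity)
    rw [div_mul_cancel₀ _ hp0.ne'] at this
    linarith
  -- The sign passes to the closure of `N`, by adding a small negative constant.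
  have hnonpos : ∀ p : X → ℝ, (∀ x ∈ S, p x ≤ 0) → f p ≤ 0 := by
    intro p hp
    refine le_of_forall_pos_lt_add fun ε hε => ?_
    have hf1 : 0 ≤ -f (fun _ => -1) := by linarith [hneg _ hone]
    have hδ : 0 < ε / (-f (fun _ => -1) + 1) := by positivity
    set δ := ε / (-f (fun _ => -1) + 1) with hδ'
    have h1 := hneg (p + δ • fun _ => -1) fun x hx => by
      have := hp x hx
      simp only [Pi.add_apply, Pi.smul_apply, smul_eq_mul]
      linarith
    rw [map_add, map_smul, smul_eq_mul] at h1
    have h2 : δ * (-f (fun _ => -1) + 1) = ε := div_mul_cancel₀ _ (by positivity)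
    nlinarith
  have hf : ∀ p, f p = ∑ x, f (Pi.single x 1) * p x := by
    intro p
    conv_lhs => rw [pi_eq_sum_univ' p]
    rw [map_sum]
    refine Finset.sum_congr rfl fun x _ => ?_
    rw [map_smul, smul_eq_mul, mul_comm]
  have hα : ∀ x, 0 ≤ f (Pi.single x 1) := by
    intro x
    have := hnonpos (-Pi.single x 1) fun y _ => by
      by_cases hy : y = x
      · subst hy; simp
      · simp [hy]
    rw [map_neg] at this
    linarith
  have hS : ∀ x ∉ S, f (Pi.single x 1) = 0 := by
    intro x hx
    refine le_antisymm (hnonpos _ fun y hy => ?_) (hα x)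
    have : y ≠ x := fun h => hx (h ▸ hy)
    simp [this]
  refine ⟨fun x => f (Pi.single x 1), hα, hS, ?_, fun p hp => ?_⟩
  -- If all weights vanished, the functional would be 0, against the strict inequality on `N`.
  · refine (Finset.sum_nonneg fun x _ => hα x).lt_of_ne fun h0 => ?_
    have h0' := (Finset.sum_eq_zero_iff_of_nonneg fun x _ => hα x).1 h0.symm
    have hz : ∀ p, f p = 0 := fun p => by
      rw [hf]
      exact Finset.sum_eq_zero fun x hx => by rw [h0' x hx, zero_mul]
    obtain ⟨p, hp⟩ := hne
    have h1 := hfN _ hone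
    have h2 := hfK p hp
    rw [hz] at h1 h2
    linarith
  · rw [← hf]
    exact hu.trans (hfK p hp)

section Hard

variable {J A : Type*}

open Classical in
/-- `cost(D, x) - L * (1 - 2 err(D, x))`. -/
noncomputable def payoff (g : (J → A) →. Bool) (L : ℝ≥0) (D : DecisionTree J A Bool)
    (x : J → A) : ℝ :=
  D.cost x - L * (if D.eval x ∈ g x then 1 else -1)

open Classical in
theorem payoff_eq (g : (J → A) →. Bool) (L : ℝ≥0) {D : DecisionTree J A Bool} {x : J → A}
    {b : Bool} (h : D.eval x = b) :
    payoff g L D x = D.cost x - L * (if b ∈ g x then 1 else -1) := by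
  subst h
  rfl

/-- A point of the convex hull is the expected payoff of a finitely supported randomised tree. No
such tree beats the ratio `L` on all of `g.Dom`, and this is what the separation lemma needs. -/
theorem exists_payoff_nonneg {g : (J → A) →. Bool} {L : ℝ≥0} (hL : L < LR g) {p : (J → A) → ℝ}
    (hp : p ∈ convexHull ℝ (Set.range fun D : {D : DecisionTree J A Bool // D.ReadOnce} =>
      payoff g L D.1)) : ∃ x ∈ g.Dom, 0 ≤ p x := by
  classical
  obtain ⟨κ, _, w, q, hw, hw1, hq, rfl⟩ := mem_convexHull_iff_exists_fintype.1 hp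
  choose D hD using hq
  have hw1' : ∑ k, ENNReal.ofReal (w k) = 1 := by
    rw [← ENNReal.ofReal_sum_of_nonneg fun k _ => hw k, hw1, ENNReal.ofReal_one]
  set R : RandomisedTree J A Bool := (PMF.ofFintype _ hw1').map D with hR
  obtain ⟨x, hx⟩ := lt_iSup_iff.1 (hL.trans_le (iInf_le _ R))
  obtain ⟨hxg, hx⟩ := lt_iSup_iff.1 hx
  refine ⟨x, hxg, ?_⟩
  have hcost : cost R x = ENNReal.ofReal (∑ k, w k * ((D k).1.cost x : ℝ)) := by
    rw [cost_eq_expect, hR, expect_map, expect, tsum_fintype,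
      ENNReal.ofReal_sum_of_nonneg fun k _ => mul_nonneg (hw k) (Nat.cast_nonneg _)]
    refine Finset.sum_congr rfl fun k _ => ?_
    rw [PMF.ofFintype_apply, ENNReal.ofReal_mul (hw k), ENNReal.ofReal_natCast]
  have herr : err g.graph R x =
      ENNReal.ofReal (∑ k, w k * (if (D k).1.eval x ∈ g x then 0 else 1)) := by
    rw [err_eq_expect, hR, expect_map, expect, tsum_fintype, ENNReal.ofReal_sum_of_nonneg]
    · refine Finset.sum_congr rfl fun k _ => ?_
      rw [PMF.ofFintype_apply, ENNReal.ofReal_mul (hw k)]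
      congr 1
      by_cases h : (D k).1.eval x ∈ g x
      · rw [if_pos h, if_pos, ENNReal.ofReal_zero]
        exact h
      · rw [if_neg h, if_neg, ENNReal.ofReal_one]
        exact h
    · intro k _
      have := hw k
      split_ifs <;> simp [this]
  -- Bias 0 makes this trivial, so the convention that the ratio is then `∞` does no harm. The
  -- truncation in `bias` only helps, as 1 - 2 err is at most the bias.
  have hbias : L * bias g.graph R x ≤ cost R x := by
    rw [costBiasRatio] at hx
    split_ifs at hx with h0
    · simp [h0]
    · exact ENNReal.mul_le_of_le_div hx.le
  rw [bias, ENNReal.mul_sub (by simp), mul_one, tsub_le_iff_right, hcost, herr] at hbias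
  have hC : 0 ≤ ∑ k, w k * ((D k).1.cost x : ℝ) :=
    Finset.sum_nonneg fun k _ => mul_nonneg (hw k) (Nat.cast_nonneg _)
  have hE : 0 ≤ ∑ k, w k * (if (D k).1.eval x ∈ g x then 0 else 1 : ℝ) :=
    Finset.sum_nonneg fun k _ => mul_nonneg (hw k) (by split_ifs <;> norm_num)
  have hreal : (L : ℝ) ≤ ∑ k, w k * ((D k).1.cost x : ℝ) +
      L * (2 * ∑ k, w k * (if (D k).1.eval x ∈ g x then 0 else 1)) := by
    rw [← ENNReal.ofReal_coe_nnreal, show (2 : ℝ≥0∞) = ENNReal.ofReal 2 by simp,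
      ← ENNReal.ofReal_mul (by norm_num), ← ENNReal.ofReal_mul L.coe_nonneg,
      ← ENNReal.ofReal_add hC (by positivity)] at hbias
    exact (ENNReal.ofReal_le_ofReal_iff (by positivity)).1 hbias
  have hval : (∑ k, w k • q k) x = ∑ k, w k * ((D k).1.cost x : ℝ) - L * ∑ k, w k +
      L * (2 * ∑ k, w k * (if (D k).1.eval x ∈ g x then 0 else 1)) := by
    rw [Finset.sum_apply, Finset.mul_sum, Finset.mul_sum, Finset.mul_sum,
      ← Finset.sum_sub_distrib, ← Finset.sum_add_distrib]
    refine Finset.sum_congr rfl fun k _ => ?_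
    rw [Pi.smul_apply, ← hD, smul_eq_mul]
    beta_reduce
    rw [payoff_eq g L rfl]
    split_ifs <;> ring
  rw [hval, hw1]
  linarith

/-- Below the linearised complexity `LR g` there are distributions on the `0`- and `1`-inputs of
`g` such that guessing the value of `g` with advantage `δ` costs at least `L * δ`. -/
theorem exists_hard_distributions [Fintype J] [DecidableEq J] [Fintype A] {g : (J → A) →. Bool}
    {L : ℝ≥0} (hL0 : 0 < L) (hL : L < LR g) :
    ∃ μ : Bool → (J → A) → ℝ≥0, (∀ b, ∑ x, μ b x = 1) ∧ (∀ b x, μ b x ≠ 0 → b ∈ g x) ∧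
      ∀ t : DecisionTree J A Bool, L * advantage μ t Finset.univ ≤
        ∑ x, ((μ false x : ℝ) + μ true x) * (t.cost x : ℝ) := by
  classical
  obtain ⟨α, hα, hdom, hpos, hK⟩ := exists_nonneg_weights (S := g.Dom) (convex_convexHull ℝ _)
    (Set.Nonempty.convexHull (Set.range_nonempty_iff_nonempty.2 ⟨⟨.leaf true, trivial⟩⟩))
    fun p hp => exists_payoff_nonneg hL hp
  have hpay : ∀ D : {D : DecisionTree J A Bool // D.ReadOnce},
      0 ≤ ∑ x, α x * payoff g L D.1 x := fun D =>
    hK _ (subset_convexHull ℝ _ ⟨D, rfl⟩)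
  set Z : Bool → ℝ := fun b => ∑ x, if b ∈ g x then α x else 0 with hZ
  have hcases : ∀ x, α x = 0 ∨ ∃ b, b ∈ g x ∧ (!b) ∉ g x := by
    intro x
    by_cases hx : x ∈ g.Dom
    · obtain ⟨b, hb⟩ := (PFun.mem_dom g x).1 hx
      exact Or.inr ⟨b, hb, fun hb' => by simpa using Part.mem_unique hb hb'⟩
    · exact Or.inl (hdom x hx)
  have hsplit : ∀ x (b : Bool),
      α x = (if b ∈ g x then α x else 0) + (if (!b) ∈ g x then α x else 0) := by
    intro x b
    rcases hcases x with h | ⟨v, hv, hv'⟩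
    · simp [h]
    · rcases Bool.eq_or_eq_not b v with rfl | rfl
      · simp [hv, hv']
      · simp [hv, hv']
  have hsgn : ∀ x (b : Bool), α x * (if b ∈ g x then 1 else -1) =
      (if b ∈ g x then α x else 0) - (if (!b) ∈ g x then α x else 0) := by
    intro x b
    rcases hcases x with h | ⟨v, hv, hv'⟩
    · simp [h]
    · rcases Bool.eq_or_eq_not b v with rfl | rfl
      · simp [hv, hv']
      · simp [hv, hv']
  have hL0' : (0 : ℝ) < L := by exact_mod_cast hL0
  -- Constant trees cost nothing, so neither can have positive advantage. Hence the 0- and 1-inputs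
  -- carry equal weight and one factor `Z true` normalises both.
  have hle : ∀ b, Z b ≤ Z (!b) := by
    intro b
    have h1 := hpay ⟨.leaf b, trivial⟩
    have h2 : ∑ x, α x * payoff g L (.leaf b) x = L * (Z (!b) - Z b) := by
      rw [hZ, ← Finset.sum_sub_distrib, Finset.mul_sum]
      refine Finset.sum_congr rfl fun x _ => ?_
      have := hsgn x b
      rw [payoff_eq g L (b := b) rfl, DecisionTree.cost, Nat.cast_zero, zero_sub]
      linear_combination -(L : ℝ) * this
    rw [h2] at h1
    linarith [nonneg_of_mul_nonneg_right h1 hL0']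
  have hZeq : ∀ b, Z b = Z true := by
    intro b
    cases b
    · exact le_antisymm (hle false) (hle true)
    · rfl
  have hZsum : ∑ x, α x = Z true + Z true := by
    nth_rewrite 2 [← hZeq (!true)]
    rw [hZ, ← Finset.sum_add_distrib]
    exact Finset.sum_congr rfl fun x _ => hsplit x _
  have hZpos : 0 < Z true := by linarith
  have hμ : ∀ b x, (((if b ∈ g x then (α x / Z true).toNNReal else 0 : ℝ≥0)) : ℝ) =
      (if b ∈ g x then α x else 0) / Z true := by
    intro b x
    split_ifs
    · exact Real.coe_toNNReal _ (div_nonneg (hα x) hZpos.le)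
    · simp
  refine ⟨fun b x => if b ∈ g x then (α x / Z true).toNNReal else 0, fun b => ?_, fun b x h => ?_,
    fun t => ?_⟩
  · rw [← NNReal.coe_inj, NNReal.coe_sum, NNReal.coe_one]
    simp only [hμ]
    rw [← Finset.sum_div, div_eq_one_iff_eq hZpos.ne']
    exact hZeq b
  · by_contra hb
    simp [hb] at h
  -- The separation covers read-once trees only; pruning `t` keeps its outputs and does not raise
  -- its cost.
  · have h1 := hpay t.toReadOnce
    simp only [advantage, hμ]
    rw [Finset.mul_sum]
    have h2 : 0 ≤ (∑ x, α x * payoff g L t.toReadOnce.1 x) / Z true := div_nonneg h1 hZpos.le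
    rw [← sub_nonneg, ← Finset.sum_sub_distrib]
    refine h2.trans ?_
    rw [Finset.sum_div]
    refine Finset.sum_le_sum fun x _ => ?_
    have h3 := hsgn x (t.eval x)
    have h4 := hsplit x false
    have h5 : (t.toReadOnce.1.cost x : ℝ) ≤ t.cost x := by exact_mod_cast t.toReadOnce_cost_le x
    rw [Bool.not_false] at h4
    rw [payoff_eq g L (t.toReadOnce_eval x), ← add_div, ← h4, ← sub_div, ← h3, div_mul_eq_mul_div, mul_div_assoc', ← sub_div]
    refine div_le_div_of_nonneg_right ?_ hZpos.le
    nlinarith [mul_le_mul_of_nonneg_left h5 (hα x)]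

end Hard

end QueryComplexity

namespace QueryComplexity

/-! ## Simulating all blocks -/

section Composition

variable {n m : ℕ} {A O : Type*}

/-- The input that offers both the bits `y` and the blocks `x`. -/
def mixedInput (y : Fin n → Bool) (x : Fin n × Fin m → A) : Fin n ⊕ Fin n × Fin m → Bool ⊕ A :=
  Sum.map y x

/-- The positions of the `i`-th block among all positions. -/
def blockIndex (i : Fin n) : Fin n ⊕ Fin n × Fin m → Option (Fin m)
  | .inl _ => none
  | .inr p => if p.1 = i then some p.2 else none

/-- The `i`-th block of `x` replaced by `w`. -/
def setBlock (x : Fin n × Fin m → A) (i : Fin n) (w : Fin m → A) : Fin n × Fin m → A := fun p =>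
  if p.1 = i then w p.2 else x p

theorem overwrite_mixedInput (i : Fin n) (y : Fin n → Bool) (x : Fin n × Fin m → A)
    (w : Fin m → A) :
    overwrite (blockIndex i) Sum.inr (mixedInput y x) w = mixedInput y (setBlock x i w) := by
  funext p
  rcases p with k | p
  · rfl
  · by_cases h : p.1 = i <;> simp [overwrite, blockIndex, mixedInput, setBlock, h]

/-- The weights of queries: `1` for a bit and `w` for a symbol of a block. -/
noncomputable def mixedWeight (w : ℝ≥0) : Fin n ⊕ Fin n × Fin m → ℝ≥0∞ :=
  Sum.elim (fun _ => 1) fun _ => w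

/-- A tree that reads blocks, as a tree on mixed inputs. -/
def liftTree (x₀ : Fin n × Fin m → A) :
    DecisionTree (Fin n × Fin m) A O → DecisionTree (Fin n ⊕ Fin n × Fin m) (Bool ⊕ A) O
  | .leaf o => .leaf o
  | .query p next => .query (.inr p) fun γ => liftTree x₀ (next (γ.elim (fun _ => x₀ p) id))

theorem liftTree_eval (x₀ : Fin n × Fin m → A) (D : DecisionTree (Fin n × Fin m) A O)
    (y : Fin n → Bool) (x : Fin n × Fin m → A) :
    (liftTree x₀ D).eval (mixedInput y x) = D.eval x := by
  induction D with
  | leaf o => rfl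
  | query p next ih => exact ih (x p)

theorem liftTree_weightedCost (w : ℝ≥0) (x₀ : Fin n × Fin m → A)
    (D : DecisionTree (Fin n × Fin m) A O) (y : Fin n → Bool) (x : Fin n × Fin m → A) :
    (liftTree x₀ D).weightedCost (mixedWeight w) (mixedInput y x) = w * D.cost x := by
  induction D with
  | leaf o => simp [liftTree, DecisionTree.weightedCost, DecisionTree.cost]
  | query p next ih =>
    rw [liftTree, DecisionTree.weightedCost, DecisionTree.cost, Nat.cast_succ, mul_add, mul_one,
      ← ih (x p)]
    rfl

/-- The tree on the bits that remains when the blocks are fixed to `x₀`. -/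
def collapse (x₀ : Fin n × Fin m → A) :
    DecisionTree (Fin n ⊕ Fin n × Fin m) (Bool ⊕ A) O → DecisionTree (Fin n) Bool O
  | .leaf o => .leaf o
  | .query (.inl i) next => .query i fun b => collapse x₀ (next (.inl b))
  | .query (.inr p) next => collapse x₀ (next (.inr (x₀ p)))

theorem collapse_eval_cost (w : ℝ≥0) (x₀ : Fin n × Fin m → A)
    (T : DecisionTree (Fin n ⊕ Fin n × Fin m) (Bool ⊕ A) O) (y : Fin n → Bool) :
    (collapse x₀ T).eval y = T.eval (mixedInput y x₀) ∧
      ((collapse x₀ T).cost y : ℝ≥0∞) ≤ T.weightedCost (mixedWeight w) (mixedInput y x₀) := by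
  induction T with
  | leaf o => simp [collapse, DecisionTree.eval, DecisionTree.cost]
  | query p next ih =>
    rcases p with i | p
    · refine ⟨(ih _).1, ?_⟩
      rw [collapse, DecisionTree.cost, DecisionTree.weightedCost, Nat.cast_succ]
      exact add_le_add_left (ih (.inl (y i))).2 _
    · refine ⟨(ih _).1, ?_⟩
      rw [collapse, DecisionTree.weightedCost]
      exact (ih (.inr (x₀ p))).2.trans le_self_add

/-- Averages of a function that is bounded on the support of the weights. -/
theorem sum_mul_le_of_support {X : Type*} [Fintype X] {μ : X → ℝ≥0} (hμ : ∑ x, μ x = 1)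
    {φ : X → ℝ≥0∞} {B : ℝ≥0∞} (h : ∀ x, μ x ≠ 0 → φ x ≤ B) : ∑ x, (μ x : ℝ≥0∞) * φ x ≤ B := by
  calc ∑ x, (μ x : ℝ≥0∞) * φ x ≤ ∑ x, (μ x : ℝ≥0∞) * B := by
        refine Finset.sum_le_sum fun x _ => ?_
        by_cases hx : μ x = 0
        · simp [hx]
        · gcongr
          exact h x hx
    _ = B := by rw [← Finset.sum_mul, ← ENNReal.ofNNReal_finsetSum, hμ, ENNReal.coe_one, one_mul]

/-- Replacing the blocks in `s` by bits preserves all bounds that hold for all valid blocks. -/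
theorem exists_simulation [Fintype A] {g : (Fin m → A) →. Bool} {w : ℝ≥0}
    {μ : Bool → (Fin m → A) → ℝ≥0} (hμ : ∀ b, ∑ x, μ b x = 1)
    (hg : ∀ b x, μ b x ≠ 0 → b ∈ g x)
    (hread : ∀ (E : DecisionTree (Fin m) A O) (b : Bool),
      1 ≤ leftover μ E Finset.univ true + w * ∑ x, μ b x * (E.cost x : ℝ≥0))
    (R : PMF (DecisionTree (Fin n ⊕ Fin n × Fin m) (Bool ⊕ A) O)) (s : Finset (Fin n)) :
    ∃ R' : PMF (DecisionTree (Fin n ⊕ Fin n × Fin m) (Bool ⊕ A) O),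
      ∀ (y : Fin n → Bool) (B : ℝ≥0∞),
        (∀ φ : O → ℝ≥0∞,
          (∀ x, (∀ i, y i ∈ g fun j => x (i, j)) →
            expect R (fun D => φ (D.eval (mixedInput y x))) ≤ B) →
          ∀ x, (∀ i ∉ s, y i ∈ g fun j => x (i, j)) →
            expect R' (fun D => φ (D.eval (mixedInput y x))) ≤ B) ∧
        ((∀ x, (∀ i, y i ∈ g fun j => x (i, j)) →
            expect R (fun D => D.weightedCost (mixedWeight w) (mixedInput y x)) ≤ B) →
          ∀ x, (∀ i ∉ s, y i ∈ g fun j => x (i, j)) →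
            expect R' (fun D => D.weightedCost (mixedWeight w) (mixedInput y x)) ≤ B) := by
  induction s using Finset.induction_on with
  | empty =>
    exact ⟨R, fun y B => ⟨fun φ h x hx => h x fun i => hx i (Finset.notMem_empty i),
      fun h x hx => h x fun i => hx i (Finset.notMem_empty i)⟩⟩
  | insert k s _ ih =>
    obtain ⟨R₁, hR₁⟩ := ih
    obtain ⟨R₂, hR₂⟩ := exists_bit_tree (blockIndex k) Sum.inr (Sum.elim id fun _ => false)
      (Sum.inl k) (c := mixedWeight (n := n) (m := m) w) rfl (w := w)
      (by rintro (i | p) hp <;> simp [blockIndex, mixedWeight] at hp ⊢) hμ hread R₁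
    -- A string drawn from `μ (y k)` is a valid block for `y k`, so the bound for `s` applies after
    -- overwriting block `k`. The blocks in `s` may already hold anything.
    have hset : ∀ (y : Fin n → Bool) (x : Fin n × Fin m → A) (v : Fin m → A),
        (∀ i ∉ insert k s, y i ∈ g fun j => x (i, j)) → μ (y k) v ≠ 0 →
        ∀ i ∉ s, y i ∈ g fun j => setBlock x k v (i, j) := by
      intro y x v hx hv i hi
      by_cases hik : i = k
      · subst hik
        simpa [setBlock] using hg _ _ hv
      · simpa [setBlock, hik] using hx i (by simp [hik, hi])
    refine ⟨R₂, fun y B => ⟨fun φ h x hx => ?_, fun h x hx => ?_⟩⟩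
    · rw [(hR₂ (mixedInput y x)).1 φ]
      refine sum_mul_le_of_support (hμ _) fun v hv => ?_
      rw [overwrite_mixedInput]
      exact (hR₁ y B).1 φ h _ (hset y x v hx hv)
    · refine ((hR₂ (mixedInput y x)).2).trans (sum_mul_le_of_support (hμ _) fun v hv => ?_)
      rw [overwrite_mixedInput]
      exact (hR₁ y B).2 h _ (hset y x v hx hv)

/-- A randomised tree for `f ∘ g` yields a randomised tree for `f` with the same error, whose
expected cost is smaller by a factor of `LR g / 4`. -/
theorem exists_outer_tree [Finite A] {f : Set ((Fin n → Bool) × O)} {g : (Fin m → A) →. Bool}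
    {L : ℝ≥0} (hL0 : 0 < L) (hL : L < LR g) {ε : ℝ} {R : RandomisedTree (Fin n × Fin m) A O}
    (hR : Computes (comp f g) ε R) {K : ℝ≥0∞} (hK : ∀ x ∈ Dom (comp f g), cost R x ≤ K) :
    ∃ R' : RandomisedTree (Fin n) Bool O, Computes f ε R' ∧
      ∀ y ∈ Dom f, cost R' y ≤ (4 / L : ℝ≥0) * K := by
  classical
  cases nonempty_fintype A
  obtain ⟨μ, hμ, hg, hard⟩ := exists_hard_distributions hL0 hL
  obtain ⟨v⟩ : Nonempty (Fin m → A) := by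
    by_contra hne
    rw [not_nonempty_iff] at hne
    simpa using hμ true
  -- Once all blocks are replaced, no validity is required of them, so any fixed filling will do.
  set x₀ : Fin n × Fin m → A := fun p => v p.2
  obtain ⟨S, hS⟩ := exists_simulation hμ hg (one_le_leftover_add_cost hμ hL0 hard)
    (R.map fun D => liftTree x₀ D.1) Finset.univ
  have hdom : ∀ y ∈ Dom f, ∀ x : Fin n × Fin m → A, (∀ i, y i ∈ g fun j => x (i, j)) →
      x ∈ Dom (comp f g) := fun y ⟨o, ho⟩ x hx => ⟨o, y, hx, ho⟩
  refine ⟨S.map fun T => (collapse x₀ T).toReadOnce, fun y hy => ?_, fun y hy => ?_⟩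
  · rw [err_eq_expect, expect_map]
    simp only [DecisionTree.toReadOnce_eval, (collapse_eval_cost 0 x₀ _ y).1]
    refine (hS y (ENNReal.ofReal ε)).1 (fun o => if (y, o) ∈ f then 0 else 1) (fun x hx => ?_) x₀
      fun i hi => absurd (Finset.mem_univ i) hi
    simp only [expect_map, liftTree_eval]
    refine le_trans (expect_mono R fun D _ => ?_)
      ((err_eq_expect (comp f g) R x).symm.trans_le (hR x (hdom y hy x hx)))
    by_cases h : (x, D.1.eval x) ∈ comp f g
    · obtain ⟨y', hy', hf⟩ := h
      -- `g` is single-valued, so the blocks determine `y`, and an output valid for `f ∘ g` is valid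
      -- for `f` on `y`.
      have : y' = y := funext fun i => Part.mem_unique (hy' i) (hx i)
      subst this
      rw [if_pos hf]
      exact zero_le
    · rw [if_neg h]
      split_ifs <;> simp
  · rw [cost_eq_expect, expect_map]
    refine (expect_mono S fun T _ => ?_).trans ((hS y ((4 / L : ℝ≥0) * K)).2 (fun x hx => ?_) x₀
      fun i hi => absurd (Finset.mem_univ i) hi)
    · exact (Nat.cast_le.2 (DecisionTree.toReadOnce_cost_le _ y)).trans
        (collapse_eval_cost (4 / L) x₀ T y).2
    · simp only [expect_map, liftTree_weightedCost, expect_const_mul]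
      gcongr
      exact hK x (hdom y hy x hx)

end Composition

/-! ## From expected to worst-case complexity -/

section WorstCase

theorem DecisionTree.cost_le_height {ι A O : Type*} [Fintype A] (D : DecisionTree ι A O)
    (x : ι → A) : D.cost x ≤ D.height := by
  induction D with
  | leaf o => exact le_rfl
  | query i next ih =>
    exact Nat.succ_le_succ ((ih _).trans
      (Finset.le_sup (f := fun a => (next a).height) (Finset.mem_univ (x i))))

variable {ι : Type*}

open Classical in
/-- Truncating a tree after `H` queries increases the error at most by its expected cost divided by
`H + 1`. -/
theorem expect_truncate_le {A O : Type*} (f : Set ((ι → A) × O)) (R : RandomisedTree ι A O)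
    (o : O) (H : ℕ) (x : ι → A) :
    expect R (fun D => if (x, (D.1.truncate o H).eval x) ∈ f then 0 else 1) ≤
      err f R x + cost R x * (H + 1 : ℝ≥0∞)⁻¹ := by
  rw [err_eq_expect, cost_eq_expect, ← expect_mul_const, ← expect_add]
  refine expect_mono R fun D _ => ?_
  by_cases h : D.1.cost x ≤ H
  · rw [DecisionTree.truncate_eval o D.1 x H h]
    exact le_self_add
  · refine le_trans ?_ le_add_self
    have h1 : (H + 1 : ℝ≥0∞) ≤ D.1.cost x := by exact_mod_cast not_le.1 h
    have h2 : (1 : ℝ≥0∞) ≤ D.1.cost x * (H + 1 : ℝ≥0∞)⁻¹ := by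
      refine (ENNReal.mul_inv_cancel (a := (H + 1 : ℝ≥0∞)) (by simp)
        (by finiteness)).symm.trans_le ?_
      gcongr
    refine le_trans ?_ h2
    split_ifs <;> simp

/-- The majority of three bits. -/
def majority (a b c : Bool) : Bool := (a && b) || (a && c) || (b && c)

/-- Run three trees and output the majority of their outputs. -/
def majorityTree {A : Type*} (D₁ D₂ D₃ : DecisionTree ι A Bool) : DecisionTree ι A Bool :=
  D₁.bind fun a => D₂.bind fun b => D₃.bind fun c => .leaf (majority a b c)

theorem majorityTree_eval {A : Type*} (D₁ D₂ D₃ : DecisionTree ι A Bool) (x : ι → A) :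
    (majorityTree D₁ D₂ D₃).eval x = majority (D₁.eval x) (D₂.eval x) (D₃.eval x) := by
  simp only [majorityTree, DecisionTree.bind_eval, DecisionTree.eval]

theorem majorityTree_height_le {A : Type*} [Fintype A] {D₁ D₂ D₃ : DecisionTree ι A Bool} {H : ℕ}
    (h₁ : D₁.height ≤ H) (h₂ : D₂.height ≤ H) (h₃ : D₃.height ≤ H) :
    (majorityTree D₁ D₂ D₃).height ≤ 3 * H := by
  have h : (majorityTree D₁ D₂ D₃).height ≤ D₁.height + (D₂.height + (D₃.height + 0)) :=
    D₁.bind_height_le _ fun _ => D₂.bind_height_le _ fun _ => D₃.bind_height_le _ fun _ => le_rfl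
  omega

/-- With q = 1 - p the left side is 3p² - 2p³, which is increasing on [0, 1] and equals 81/256 < 1/3
at p = 3/8. -/
theorem majority_error_le {p q : ℝ≥0∞} (hpq : p + q = 1) (hp : p ≤ ENNReal.ofReal (3 / 8)) :
    p * p + p * (q * p) + q * (p * p) ≤ ENNReal.ofReal (1 / 3) := by
  have hpT : p ≠ ∞ := ne_top_of_le_ne_top ENNReal.ofReal_ne_top hp
  have hqT : q ≠ ∞ := ne_top_of_le_ne_top (b := 1) (by simp) (hpq ▸ le_add_self)
  lift p to ℝ≥0 using hpT
  lift q to ℝ≥0 using hqT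
  have h1 : (p : ℝ) + q = 1 := by exact_mod_cast hpq
  have h2 : (p : ℝ) ≤ 3 / 8 := by
    rw [← ENNReal.ofReal_coe_nnreal] at hp
    exact (ENNReal.ofReal_le_ofReal_iff (by norm_num)).1 hp
  have h3 : (q : ℝ) = 1 - p := by linarith
  have h4 : (0 : ℝ) ≤ p := p.coe_nonneg
  rw [← ENNReal.coe_mul, ← ENNReal.coe_mul, ← ENNReal.coe_mul, ← ENNReal.coe_mul,
    ← ENNReal.coe_add, ← ENNReal.coe_add, ← ENNReal.ofReal_coe_nnreal]
  refine ENNReal.ofReal_le_ofReal ?_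
  push_cast
  rw [h3]
  nlinarith [mul_nonneg h4 h4, mul_nonneg h4 (sub_nonneg.2 h2),
    mul_nonneg (mul_nonneg h4 h4) (sub_nonneg.2 h2)]

/-- For partial Boolean functions, an expected cost of `K` with error `1 / 3` can be turned into a
worst-case cost of `72 * K`. -/
theorem worstCaseComplexity_le {n : ℕ} (f : (Fin n → Bool) →. Bool)
    {R : RandomisedTree (Fin n) Bool Bool} (hR : Computes f.graph (1 / 3) R) {K : ℝ≥0}
    (hK : ∀ x ∈ Dom f.graph, cost R x ≤ K) :
    worstCaseComplexity (1 / 3) f.graph ≤ 72 * K := by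
  classical
  -- Since `H + 1` exceeds `24 * K`, truncation adds at most 1/24 to the error, and 1/3 + 1/24 =
  -- 3/8.
  set H : ℕ := ⌊24 * K⌋₊ with hH
  set S : PMF (DecisionTree (Fin n) Bool Bool) := R.map fun D => D.1.truncate true H with hS
  have hheight : ∀ D ∈ S.support, D.height ≤ H := by
    intro D hD
    rw [hS, PMF.mem_support_map_iff] at hD
    obtain ⟨D', _, rfl⟩ := hD
    exact DecisionTree.truncate_height_le _ _ _
  set R' : RandomisedTree (Fin n) Bool Bool := S.bind fun D₁ => S.bind fun D₂ => S.map fun D₃ =>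
    (majorityTree D₁ D₂ D₃).toReadOnce with hR'
  have hle : worstCaseComplexity (1 / 3) f.graph ≤ ((3 * H : ℕ) : ℝ≥0∞) := by
    refine iInf₂_le _ ⟨R', fun x hx => ?_, fun D hD => ?_⟩
    · set W : DecisionTree (Fin n) Bool Bool → ℝ≥0∞ :=
        fun D => if (x, D.eval x) ∈ f.graph then 0 else 1 with hW
      set G : DecisionTree (Fin n) Bool Bool → ℝ≥0∞ :=
        fun D => if (x, D.eval x) ∈ f.graph then 1 else 0 with hG
      have hpq : expect S W + expect S G = 1 := by
        rw [← expect_add, ← expect_const S 1]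
        congr 1
        funext D
        simp only [hW, hG]
        split_ifs <;> simp
      have hp : expect S W ≤ ENNReal.ofReal (3 / 8) := by
        rw [hS, expect_map]
        refine (expect_truncate_le f.graph R true H x).trans ?_
        have h1 : cost R x * (H + 1 : ℝ≥0∞)⁻¹ ≤ ENNReal.ofReal (1 / 24) := by
          have h2 : 24 * K ≤ (H + 1 : ℝ≥0) := (Nat.lt_floor_add_one _).le
          have h3 : K ≤ (1 / 24) * (H + 1 : ℝ≥0) := by
            rw [one_div, ← div_eq_inv_mul, le_div_iff₀ (by norm_num), mul_comm]
            exact h2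
          rw [← div_eq_mul_inv]
          refine ENNReal.div_le_of_le_mul ((hK x hx).trans ?_)
          have h4 : ENNReal.ofReal (1 / 24) = ((1 / 24 : ℝ≥0) : ℝ≥0∞) := by
            rw [← ENNReal.ofReal_coe_nnreal]
            norm_num
          rw [h4]
          exact_mod_cast h3
        refine (add_le_add (hR x hx) h1).trans_eq ?_
        rw [← ENNReal.ofReal_add (by norm_num) (by norm_num)]
        norm_num
      refine le_trans ?_ (majority_error_le hpq hp)
      simp only [err_eq_expect, hR', expect_bind, expect_map, DecisionTree.toReadOnce_eval,
        majorityTree_eval]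
      have hprod : expect S W * expect S W + expect S W * (expect S G * expect S W) +
          expect S G * (expect S W * expect S W) =
          expect S fun D₁ => expect S fun D₂ => expect S fun D₃ =>
            W D₁ * W D₂ + W D₁ * (G D₂ * W D₃) + G D₁ * (W D₂ * W D₃) := by
        simp only [expect_add, expect_const_mul, expect_mul_const, expect_const]
      rw [hprod]
      refine expect_mono S fun D₁ _ => expect_mono S fun D₂ _ => expect_mono S fun D₃ _ => ?_
      obtain ⟨v, hv⟩ := hx
      -- There is exactly one valid output, so the majority is wrong only if at least two of the
      -- three runs are.
      have hval : ∀ b, (x, b) ∈ f.graph ↔ b = v := fun b =>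
        ⟨fun h => Part.mem_unique h hv, fun h => h ▸ hv⟩
      simp only [hW, hG, hval]
      generalize D₁.eval x = a, D₂.eval x = b, D₃.eval x = c
      cases a <;> cases b <;> cases c <;> cases v <;> simp [majority]
    · rw [hR'] at hD
      simp only [PMF.mem_support_bind_iff, PMF.mem_support_map_iff] at hD
      obtain ⟨D₁, h₁, D₂, h₂, D₃, h₃, rfl⟩ := hD
      exact (DecisionTree.toReadOnce_height_le _).trans
        (majorityTree_height_le (hheight _ h₁) (hheight _ h₂) (hheight _ h₃))
  refine hle.trans ?_
  have h1 : (H : ℝ≥0) ≤ 24 * K := Nat.floor_le zero_le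
  have h2 : ((3 * H : ℕ) : ℝ≥0) ≤ 72 * K := by
    push_cast
    calc (3 : ℝ≥0) * H ≤ 3 * (24 * K) := by gcongr
      _ = 72 * K := by ring
  exact_mod_cast h2

end WorstCase

/-! ### The two composition inequalities -/

/-- The expected complexity of `f` is at most `4 / LR g` times that of `f ∘ g`. -/
theorem expectedComplexity_mul_LR_le {A O : Type*} [Finite A] {n m : ℕ}
    (f : Set ((Fin n → Bool) × O)) (g : (Fin m → A) →. Bool) (ε : ℝ) :
    expectedComplexity ε f * LR g ≤ 4 * expectedComplexity ε (comp f g) := by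
  rw [expectedComplexity, expectedComplexity, ENNReal.mul_iInf_of_ne (by simp) (by simp)]
  refine le_iInf fun R => ?_
  rw [ENNReal.mul_iInf_of_ne (by simp) (by simp)]
  -- Approximating both factors strictly from below makes `b` finite even if `LR g = ∞`, and
  -- respects 0 · ∞ = 0.
  refine le_iInf fun hR => ENNReal.mul_le_of_forall_lt fun a ha b hb => ?_
  lift b to ℝ≥0 using hb.ne_top
  rcases eq_zero_or_pos b with rfl | hb0
  · simp
  obtain ⟨R', hR', hcost⟩ := exists_outer_tree hb0 hb hR
    (K := ⨆ x ∈ Dom (comp f g), cost R x) fun x hx => le_iSup₂ (f := fun x _ => cost R x) x hx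
  have h1 : a ≤ (4 / b : ℝ≥0) * ⨆ x ∈ Dom (comp f g), cost R x :=
    ha.le.trans ((iInf₂_le R' hR').trans (iSup₂_le hcost))
  calc a * b ≤ (4 / b : ℝ≥0) * (⨆ x ∈ Dom (comp f g), cost R x) * b := by gcongr
    _ = ((4 / b * b : ℝ≥0) : ℝ≥0∞) * ⨆ x ∈ Dom (comp f g), cost R x := by push_cast; ring
    _ = _ := by rw [div_mul_cancel₀ _ hb0.ne']; rfl

/-- The worst-case complexity of `f` is at most `288 / LR g` times that of `f ∘ g`. -/
theorem worstCaseComplexity_mul_LR_le {A : Type*} [Fintype A] {n m : ℕ}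
    (f : (Fin n → Bool) →. Bool) (g : (Fin m → A) →. Bool) :
    worstCaseComplexity (1 / 3) f.graph * LR g ≤
      288 * worstCaseComplexity (1 / 3) (comp f.graph g) := by
  rw [worstCaseComplexity, worstCaseComplexity, ENNReal.mul_iInf_of_ne (by simp) (by simp)]
  refine le_iInf fun T => ?_
  rw [ENNReal.mul_iInf_of_ne (by simp) (by simp)]
  refine le_iInf fun ⟨R, hR, hT⟩ => ENNReal.mul_le_of_forall_lt fun a ha b hb => ?_
  lift b to ℝ≥0 using hb.ne_top
  rcases eq_zero_or_pos b with rfl | hb0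
  · simp
  have hcostR : ∀ x ∈ Dom (comp f.graph g), cost R x ≤ (T : ℝ≥0∞) := by
    intro x _
    rw [cost_eq_expect, ← expect_const R (T : ℝ≥0∞)]
    exact expect_mono R fun D hD => Nat.cast_le.2 ((D.1.cost_le_height x).trans (hT D hD))
  obtain ⟨R', hR', hcost⟩ := exists_outer_tree hb0 hb hR hcostR
  have h1 : a ≤ 72 * ((4 / b * T : ℝ≥0) : ℝ≥0∞) :=
    ha.le.trans (worstCaseComplexity_le f hR' fun x hx => (hcost x hx).trans_eq (by push_cast; rfl))
  calc a * b ≤ 72 * ((4 / b * T : ℝ≥0) : ℝ≥0∞) * b := by gcongr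
    _ = ((72 * (4 / b * b) * T : ℝ≥0) : ℝ≥0∞) := by push_cast; ring
    _ = _ := by
      rw [div_mul_cancel₀ _ hb0.ne']
      push_cast
      norm_num

end QueryComplexity

/-- The composition theorem `R(f ∘ g) ≥ Ω(R(f) LR(g))` for partial Boolean functions, together
with its general form for the expected `ε`-error complexity of a relation `f` composed with a
partial Boolean-valued function `g` over an arbitrary finite alphabet. -/
theorem theorem1p2 :
    (∃ c : ℝ≥0, 0 < c ∧
      ∀ (n m : ℕ) (f : (Fin n → Bool) →. Bool) (g : (Fin m → Bool) →. Bool),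
        (c : ℝ≥0∞) * (QueryComplexity.worstCaseComplexity (1 / 3) f.graph * QueryComplexity.LR g) ≤
          QueryComplexity.worstCaseComplexity (1 / 3) (QueryComplexity.comp f.graph g)) ∧
    (∀ (A O : Type*) [Finite A] [Finite O] (n m : ℕ)
        (f : Set ((Fin n → Bool) × O)) (g : (Fin m → A) →. Bool) (ε : ℝ),
        0 ≤ ε → ε < 1 / 2 →
        QueryComplexity.expectedComplexity ε f * QueryComplexity.LR g / 6 ≤
          QueryComplexity.expectedComplexity ε (QueryComplexity.comp f g)) := by
  refine ⟨⟨1 / 288, by norm_num, fun n m f g => ?_⟩, fun A O _ _ n m f g ε _ _ => ?_⟩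
  · have h : ((1 / 288 : ℝ≥0) : ℝ≥0∞) * 288 = 1 := by
      exact_mod_cast (by norm_num : (1 / 288 : ℝ≥0) * 288 = 1)
    calc _ ≤ ((1 / 288 : ℝ≥0) : ℝ≥0∞) * (288 * QueryComplexity.worstCaseComplexity (1 / 3)
          (QueryComplexity.comp f.graph g)) := by
          exact mul_le_mul_right (QueryComplexity.worstCaseComplexity_mul_LR_le f g) _
      _ = _ := by rw [← mul_assoc, h, one_mul]
  · refine ENNReal.div_le_of_le_mul
      ((QueryComplexity.expectedComplexity_mul_LR_le f g ε).trans ?_)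
    rw [mul_comm]
    gcongr
    norm_num
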